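/- Let $\mathcal A$ be a set of agents and $P$ a set of propositional variables. **Models.** A prewellorder is a total, transitive relation $\le$ whose strict part ($x\le y$ and not $y\le x$) is well-founded. A plausibility epistemic model $M=(S,\sim,\le,V)$ consists of a set of states $S$, for every agent $a$ an equivalence relation $\sim_a$ and a plausibility relation $\le_a$ on $S$ whose restriction to each $\sim_a$-class is a prewellorder ($s\le_a t$: $s$ is at least as plausible as $t$), and a valuation $V:P\to\mathcal P(S)$. A plausibility action model $(E,\approx,\preceq,\mathrm{pre})$ is defined in the same way, with a precondition $\mathrm{pre}(\alpha)$ for each action $\alpha\in E$ instead of a valuation. The update $M\otimes E$ has as states the pairs $(s,\alpha)$ with $M,s\models\mathrm{pre}(\alpha)$; $(s,\alpha)\sim_a(t,\beta)$ iff $s\sim_a t$ and $\alpha\approx_a\beta$; $(s,\alpha)\le_a(t,\beta)$ iff $\alpha\prec_a\beta$, or $\alpha,\beta$ are equally plausible for $a$ and $s\le_a t$; valuations are inherited from $S$. (So $(s,\alpha)<_a(t,\beta)$ iff $\alpha\prec_a\beta$, or $\alpha,\beta$ are equally plausible and $s<_a t$.) **Languages.** Both languages have propositional variables, $\neg$,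 $\wedge$, $B_a\varphi$ (belief), $K_a\varphi$ (knowledge), $B_a^\chi\varphi$ (conditional belief), and announcement operators $[x]\psi$. In the language of plausible public lying, $x$ is $!\varphi$ (truthful) or $¡\varphi$ (lying); in the language of plausible agent lying, $x$ is $!_a\varphi$ (truthful), $¡!_a\varphi$ (bluffing) or $¡_a\varphi$ (lying), for any agent $a$. Write $\langle x\rangle\psi$ for $\neg[x]\neg\psi$. **Semantics.** $K_a\varphi$ is true in $s$ iff $\varphi$ is true in all $t\sim_a s$; $B_a\varphi$ is true in $s$ iff $\varphi$ is true in all $\le_a$-least states of the $\sim_a$-class of $s$; $B_a^\chi\varphi$ is true in $s$ iff $\varphi$ is true in all states that are $\le_a$-least among the $\chi$-states of the $\sim_a$-class of $s$. $[x]\psi$ is true in $s$ iff, if the precondition of $x$ is true in $s$, then $\psi$ is true in $(s,x)$ in the update of $M$ with the following action model. * Public: actions $!$ and $¡$ with preconditions $\varphi$ and $\neg\varphi$; for all agents both actions are indistinguishable and $!\prec ¡$. * Agent: actions $!_a$, $¡!_a$, $¡_a$ with preconditions $B_a\varphi$, $\neg(B_a\varphi\vee B_a\neg\varphi)$, $B_a\neg\varphi$;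 agent $a$ distinguishes all three actions; for every other agent they are indistinguishable and $!_a\prec ¡!_a\prec ¡_a$. A formula is valid iff it is true in all states of all plausibility epistemic models. **Axiomatizations.** Both have the following axioms and rules. * All instances of propositional tautologies; modus ponens. * Conditional doxastic logic: from $\varphi$ infer $B_a^\chi\varphi$; from $\chi\leftrightarrow\chi'$ infer $B_a^\chi\varphi\leftrightarrow B_a^{\chi'}\varphi$; $B_a^\chi(\varphi\to\psi)\to(B_a^\chi\varphi\to B_a^\chi\psi)$; $B_a\varphi\leftrightarrow B_a^{\varphi\to\varphi}\varphi$; $K_a\varphi\leftrightarrow B_a^{\neg\varphi}\varphi$; $K_a\varphi\to\varphi$; $K_a\varphi\to B_a^\chi\varphi$; $B_a^\chi\varphi\to K_aB_a^\chi\varphi$; $\neg B_a^\chi\varphi\to K_a\neg B_a^\chi\varphi$; $B_a^\varphi\varphi$; $\neg B_a^\varphi\neg\psi\to(B_a^{\varphi\wedge\psi}\chi\leftrightarrow B_a^\varphi(\psi\to\chi))$. * Announcement operators: from $\psi$ infer $[x]\psi$; $[x](\psi\to\chi)\to([x]\psi\to[x]\chi)$; $[x]p\leftrightarrow(\mathrm{pre}(x)\to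 p)$; $[x]\neg\psi\leftrightarrow(\mathrm{pre}(x)\to\neg[x]\psi)$; $[x](\psi\wedge\chi)\leftrightarrow([x]\psi\wedge[x]\chi)$. In addition, the public logic has, for $x\in\{!\varphi,¡\varphi\}$, the reduction axiom $$[x]B_a^\chi\psi\leftrightarrow\Bigl(\mathrm{pre}(x)\to\bigl(\neg K_a\neg\langle !\varphi\rangle\chi\to B_a^{\langle !\varphi\rangle\chi}[!\varphi]\psi\bigr)\wedge\bigl(K_a\neg\langle !\varphi\rangle\chi\to B_a^{\langle ¡\varphi\rangle\chi}[¡\varphi]\psi\bigr)\Bigr),$$ and the agent logic has, for $x\in\{!_a\varphi,¡!_a\varphi,¡_a\varphi\}$, the reduction axioms $$[x]B_a^\chi\psi\leftrightarrow\bigl(\mathrm{pre}(x)\to B_a^{\langle x\rangle\chi}[x]\psi\bigr)$$ for the speaker $a$ and, for each agent $b\ne a$, $$[x]B_b^\chi\psi\leftrightarrow\Bigl(\mathrm{pre}(x)\to\bigl(\neg\kappa_!\to B_b^{\langle !_a\varphi\rangle\chi}[!_a\varphi]\psi\bigr)\wedge\bigl(\kappa_!\wedge\neg\kappa_{¡!}\to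 B_b^{\langle ¡!_a\varphi\rangle\chi}[¡!_a\varphi]\psi\bigr)\wedge\bigl(\kappa_!\wedge\kappa_{¡!}\to B_b^{\langle ¡_a\varphi\rangle\chi}[¡_a\varphi]\psi\bigr)\Bigr),$$ where $\kappa_!=K_b\neg\langle !_a\varphi\rangle\chi$ and $\kappa_{¡!}=K_b\neg\langle ¡!_a\varphi\rangle\chi$. **Proposition.** Both axiomatizations are sound and complete: a formula of the language of plausible public lying is derivable in the axiomatization of the public logic iff it is valid, and a formula of the language of plausible agent lying is derivable in the axiomatization of the agent logic iff it is valid. -/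

import Mathlib

universe u v

namespace PlausLying

/-! ## Plausibility epistemic models -/

/-- The restriction of `r` to `S` is a prewellorder: it is total and transitive on `S`, and its
strict part is well-founded on `S`. (`r x y` is read "`x` is at least as plausible as `y`".) -/
def IsPrewellorderOn {X : Type u} (r : X → X → Prop) (S : Set X) : Prop :=
  (∀ x ∈ S, ∀ y ∈ S, r x y ∨ r y x) ∧
  (∀ x ∈ S, ∀ y ∈ S, ∀ z ∈ S, r x y → r y z → r x z) ∧
  S.WellFoundedOn (fun x y => r x y ∧ ¬ r y x)

/-- Plausibility epistemic models. `sim a` is the epistemic equivalence of agent `a`;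
`le a s t` says that `a` considers `s` at least as plausible as `t`; the strict plausibility
relation `s <ₐ t` is `le a s t ∧ ¬ le a t s`. -/
structure PlausModel (Agent Atom : Type u) where
  State : Type u
  sim : Agent → State → State → Prop
  le : Agent → State → State → Prop
  val : Atom → Set State
  sim_equiv : ∀ a, Equivalence (sim a)
  le_prewellorder : ∀ a s, IsPrewellorderOn (le a) {t | sim a s t}

/-- Plausibility action models, with preconditions in `L`. -/
structure PlausActionModel (Agent : Type u) (L : Type v) where
  Action : Type
  sim : Agent → Action → Action → Prop
  le : Agent → Action → Action → Prop
  pre : Action → L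
  sim_equiv : ∀ a, Equivalence (sim a)
  le_prewellorder : ∀ a α, IsPrewellorderOn (le a) {β | sim a α β}

/-- Plausibility epistemic actions: pointed plausibility action models. -/
structure PlausAction (Agent : Type u) (L : Type v) extends PlausActionModel Agent L where
  point : Action

/-- The action-priority (anti-lexicographic) order: first compare actions, and compare states
only if the actions are equally plausible. -/
def actionPriority {S : Type u} {A : Type v} (leA : A → A → Prop) (leS : S → S → Prop)
    (x y : S × A) : Prop :=
  (leA x.2 y.2 ∧ ¬ leA y.2 x.2) ∨ ((leA x.2 y.2 ∧ leA y.2 x.2) ∧ leS x.1 y.1)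

theorem IsPrewellorderOn.exists_least {X : Type u} {r : X → X → Prop} {S : Set X}
    (h : IsPrewellorderOn r S) (T : Set X) (hT : T ⊆ S) (hne : T.Nonempty) :
    ∃ m ∈ T, ∀ x ∈ T, r m x := by
  obtain ⟨htot, _, hwf⟩ := h
  have hwf' := hwf.subset hT
  rw [Set.wellFoundedOn_iff] at hwf'
  obtain ⟨m, hm, hmin⟩ := hwf'.has_min T hne
  refine ⟨m, hm, fun x hx => ?_⟩
  rcases htot m (hT hm) x (hT hx) with h1 | h1
  · exact h1
  · by_contra h2
    exact hmin x hx ⟨⟨h1, h2⟩, hx, hm⟩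

theorem isPrewellorderOn_of_least {X : Type u} {r : X → X → Prop} {S : Set X}
    (htot : ∀ x ∈ S, ∀ y ∈ S, r x y ∨ r y x)
    (htr : ∀ x ∈ S, ∀ y ∈ S, ∀ z ∈ S, r x y → r y z → r x z)
    (h : ∀ T ⊆ S, T.Nonempty → ∃ m ∈ T, ∀ x ∈ T, r m x) : IsPrewellorderOn r S := by
  refine ⟨htot, htr, ?_⟩
  rw [Set.wellFoundedOn_iff, WellFounded.wellFounded_iff_has_min]
  intro T hne
  by_cases hTS : (T ∩ S).Nonempty
  · obtain ⟨m, hm, hmin⟩ := h (T ∩ S) Set.inter_subset_right hTS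
    exact ⟨m, hm.1, fun x hx ⟨⟨_, h2⟩, h3, _⟩ => h2 (hmin x ⟨hx, h3⟩)⟩
  · obtain ⟨m, hm⟩ := hne
    exact ⟨m, hm, fun x hx ⟨_, h3, _⟩ => hTS ⟨x, hx, h3⟩⟩

theorem isPrewellorderOn_actionPriority {S : Type u} {A : Type v} {leA : A → A → Prop}
    {leS : S → S → Prop} {P : Set S} {Q : Set A} (hA : IsPrewellorderOn leA Q)
    (hS : IsPrewellorderOn leS P) (D : S × A → Prop) :
    IsPrewellorderOn (fun x y : {q : S × A // D q} => actionPriority leA leS x.1 y.1)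
      {x | x.1.1 ∈ P ∧ x.1.2 ∈ Q} := by
  have htA := hA.1
  have htrA := hA.2.1
  have htS := hS.1
  have htrS := hS.2.1
  refine isPrewellorderOn_of_least ?_ ?_ ?_
  · rintro ⟨⟨s, α⟩, _⟩ ⟨hs, hα⟩ ⟨⟨t, β⟩, _⟩ ⟨ht, hβ⟩
    have h1 := htA α hα β hβ
    have h2 := htS s hs t ht
    simp only [actionPriority]
    tauto
  · rintro ⟨⟨s, α⟩, _⟩ ⟨hs, hα⟩ ⟨⟨t, β⟩, _⟩ ⟨ht, hβ⟩ ⟨⟨w, γ⟩, _⟩ ⟨hw, hγ⟩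
    have h1 := htrA α hα β hβ γ hγ
    have h2 := htrA γ hγ α hα β hβ
    have h3 := htrA β hβ γ hγ α hα
    have h4 := htrA γ hγ β hβ α hα
    have h5 := htrS s hs t ht w hw
    simp only [actionPriority]
    tauto
  · intro T hT hne
    obtain ⟨α, hα, hαmin⟩ := hA.exists_least ((fun x : {q : S × A // D q} => x.1.2) '' T)
      (by rintro _ ⟨x, hx, rfl⟩; exact (hT hx).2) (hne.image _)
    obtain ⟨s, ⟨x, ⟨hx, hxα, hαx⟩, rfl⟩, hsmin⟩ := hS.exists_least
      ((fun x : {q : S × A // D q} => x.1.1) '' {x ∈ T | leA x.1.2 α ∧ leA α x.1.2})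
      (by rintro _ ⟨x, hx, rfl⟩; exact (hT hx.1).1)
      (by
        obtain ⟨x, hx, rfl⟩ := hα
        have hr := hαmin _ ⟨x, hx, rfl⟩
        exact ⟨_, x, ⟨hx, hr, hr⟩, rfl⟩)
    have hαQ : α ∈ Q := by
      obtain ⟨y, hy, rfl⟩ := hα
      exact (hT hy).2
    refine ⟨x, hx, fun y hy => ?_⟩
    have hαy := hαmin _ ⟨y, hy, rfl⟩
    have hxy : leA x.1.2 y.1.2 := htrA _ (hT hx).2 _ hαQ _ (hT hy).2 hxα hαy
    by_cases hyx : leA y.1.2 x.1.2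
    · exact Or.inr ⟨⟨hxy, hyx⟩, hsmin _
        ⟨y, ⟨hy, htrA _ (hT hy).2 _ (hT hx).2 _ hαQ hyx hxα, hαy⟩, rfl⟩⟩
    · exact Or.inl ⟨hxy, hyx⟩

/-- The update `M ⊗ A` of a model with an action model whose preconditions are given by their
truth sets in `M`. Its strict plausibility relation is: `(s, α) < (t, β)` iff `α ≺ β`, or
`α` and `β` are equally plausible and `s < t`. -/
def PlausModel.update {Agent Atom : Type u} (M : PlausModel Agent Atom)
    (A : PlausActionModel Agent (Set M.State)) : PlausModel Agent Atom where
  State := {q : M.State × A.Action // q.1 ∈ A.pre q.2}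
  sim a x y := M.sim a x.1.1 y.1.1 ∧ A.sim a x.1.2 y.1.2
  le a x y := actionPriority (A.le a) (M.le a) x.1 y.1
  val p := {x | x.1.1 ∈ M.val p}
  sim_equiv a :=
    ⟨fun _ => ⟨(M.sim_equiv a).refl _, (A.sim_equiv a).refl _⟩,
      fun h => ⟨(M.sim_equiv a).symm h.1, (A.sim_equiv a).symm h.2⟩,
      fun h k => ⟨(M.sim_equiv a).trans h.1 k.1, (A.sim_equiv a).trans h.2 k.2⟩⟩
  le_prewellorder a x :=
    isPrewellorderOn_actionPriority (A.le_prewellorder a x.1.2) (M.le_prewellorder a x.1.1) _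

section Operators

variable {Agent Atom : Type u} (M : PlausModel Agent Atom)

/-- Knowledge: `P` holds in all equivalent states. -/
def PlausModel.Know (a : Agent) (P : Set M.State) : Set M.State :=
  {s | ∀ t, M.sim a s t → t ∈ P}

/-- The accessibility relation for belief: `t` is a most plausible state equivalent to `s`. -/
def PlausModel.R (a : Agent) (s t : M.State) : Prop :=
  M.sim a s t ∧ ∀ t', M.sim a s t' → M.le a t t'

/-- Belief. -/
def PlausModel.Bel (a : Agent) (P : Set M.State) : Set M.State :=
  {s | ∀ t, M.R a s t → t ∈ P}

/-- The accessibility relation for belief conditional on `C`: `t` is a most plausible one among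
the states in `C` that are equivalent to `s`. -/
def PlausModel.RCond (a : Agent) (C : Set M.State) (s t : M.State) : Prop :=
  (M.sim a s t ∧ t ∈ C) ∧ ∀ t', M.sim a s t' → t' ∈ C → M.le a t t'

/-- Conditional belief. -/
def PlausModel.CBel (a : Agent) (C P : Set M.State) : Set M.State :=
  {s | ∀ t, M.RCond a C s t → t ∈ P}

end Operators

/-! ## Languages with announcement operators, and their semantics -/

/-- Formulas. `bel a φ` is `Bₐ φ`, `know a φ` is `Kₐ φ`, `cbel a χ φ` is `Bₐ^χ φ`, and
`after o φ ψ` is `[o φ] ψ` for an announcement operator `o`. -/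
inductive Form (Agent Atom : Type u) (Op : Type v) : Type (max u v)
  | atom : Atom → Form Agent Atom Op
  | neg : Form Agent Atom Op → Form Agent Atom Op
  | and : Form Agent Atom Op → Form Agent Atom Op → Form Agent Atom Op
  | bel : Agent → Form Agent Atom Op → Form Agent Atom Op
  | know : Agent → Form Agent Atom Op → Form Agent Atom Op
  | cbel : Agent → Form Agent Atom Op → Form Agent Atom Op → Form Agent Atom Op
  | after : Op → Form Agent Atom Op → Form Agent Atom Op → Form Agent Atom Op

namespace Form

variable {Agent Atom : Type u} {Op : Type v}

def or (φ ψ : Form Agent Atom Op) : Form Agent Atom Op := neg (and (neg φ) (neg ψ))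

def imp (φ ψ : Form Agent Atom Op) : Form Agent Atom Op := neg (and φ (neg ψ))

def iff (φ ψ : Form Agent Atom Op) : Form Agent Atom Op := and (imp φ ψ) (imp ψ φ)

/-- The dual `⟨o φ⟩ ψ` of `[o φ] ψ`. -/
def dia (o : Op) (φ ψ : Form Agent Atom Op) : Form Agent Atom Op := neg (after o φ (neg ψ))

/-- Instances of propositional tautologies. -/
def IsTautology (φ : Form Agent Atom Op) : Prop :=
  ∀ w : Form Agent Atom Op → Prop, (∀ ψ, w (neg ψ) ↔ ¬ w ψ) →
    (∀ ψ χ, w (and ψ χ) ↔ w ψ ∧ w χ) → w φ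

/-- The truth set of a formula in a model. The argument `act` gives, for every operator `o` and
every model, the plausibility epistemic action that `o` performs when applied to a formula with
truth set `P`; `[o φ] ψ` is true in `s` iff, if the precondition holds in `s`, then `ψ` is true
in the corresponding state of the updated model. -/
def truth (act : Op → (M : PlausModel Agent Atom) → Set M.State →
    PlausAction Agent (Set M.State)) :
    Form Agent Atom Op → (M : PlausModel Agent Atom) → Set M.State
  | atom p, M => M.val p
  | neg φ, M => (truth act φ M)ᶜ
  | and φ ψ, M => truth act φ M ∩ truth act ψ M
  | bel a φ, M => M.Bel a (truth act φ M)
  | know a φ, M => M.Know a (truth act φ M)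
  | cbel a χ φ, M => M.CBel a (truth act χ M) (truth act φ M)
  | after o φ ψ, M =>
      {s | ∀ h : s ∈ (act o M (truth act φ M)).pre (act o M (truth act φ M)).point,
        (⟨(s, (act o M (truth act φ M)).point), h⟩ :
            (M.update (act o M (truth act φ M)).toPlausActionModel).State) ∈
          truth act ψ (M.update (act o M (truth act φ M)).toPlausActionModel)}

/-- Truth in all states of all plausibility epistemic models. -/
def Valid (act : Op → (M : PlausModel Agent Atom) → Set M.State →
    PlausAction Agent (Set M.State)) (φ : Form Agent Atom Op) : Prop :=
  ∀ (M : PlausModel Agent Atom) (s : M.State), s ∈ truth act φ M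

/-- Hilbert-style derivability: conditional doxastic logic, normality of the announcement
operators, the reduction axioms for atoms, negation and conjunction (where `pre o φ` is the
precondition of `[o φ]`), and the reduction axioms in `Red` for conditional belief. -/
inductive Derivable (pre : Op → Form Agent Atom Op → Form Agent Atom Op)
    (Red : Form Agent Atom Op → Prop) : Form Agent Atom Op → Prop
  | taut (φ) : IsTautology φ → Derivable pre Red φ
  | mp (φ ψ) : Derivable pre Red (imp φ ψ) → Derivable pre Red φ → Derivable pre Red ψ
  -- conditional doxastic logic
  | cbel_nec (a χ φ) : Derivable pre Red φ → Derivable pre Red (cbel a χ φ)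
  | cbel_congr (a χ χ' φ) : Derivable pre Red (iff χ χ') →
      Derivable pre Red (iff (cbel a χ φ) (cbel a χ' φ))
  | cbel_normal (a χ φ ψ) :
      Derivable pre Red (imp (cbel a χ (imp φ ψ)) (imp (cbel a χ φ) (cbel a χ ψ)))
  | bel_def (a φ) : Derivable pre Red (iff (bel a φ) (cbel a (imp φ φ) φ))
  | know_def (a φ) : Derivable pre Red (iff (know a φ) (cbel a (neg φ) φ))
  | truthfulness (a φ) : Derivable pre Red (imp (know a φ) φ)
  | persistence (a χ φ) : Derivable pre Red (imp (know a φ) (cbel a χ φ))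
  | pos_introspection (a χ φ) :
      Derivable pre Red (imp (cbel a χ φ) (know a (cbel a χ φ)))
  | neg_introspection (a χ φ) :
      Derivable pre Red (imp (neg (cbel a χ φ)) (know a (neg (cbel a χ φ))))
  | success (a φ) : Derivable pre Red (cbel a φ φ)
  | minimality (a φ ψ χ) :
      Derivable pre Red (imp (neg (cbel a φ (neg ψ)))
        (iff (cbel a (and φ ψ) χ) (cbel a φ (imp ψ χ))))
  -- announcement operators
  | after_nec (o φ ψ) : Derivable pre Red ψ → Derivable pre Red (after o φ ψ)
  | after_normal (o φ ψ χ) :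
      Derivable pre Red (imp (after o φ (imp ψ χ)) (imp (after o φ ψ) (after o φ χ)))
  | after_atom (o φ p) :
      Derivable pre Red (iff (after o φ (atom p)) (imp (pre o φ) (atom p)))
  | after_neg (o φ ψ) :
      Derivable pre Red (iff (after o φ (neg ψ)) (imp (pre o φ) (neg (after o φ ψ))))
  | after_and (o φ ψ χ) :
      Derivable pre Red
        (iff (after o φ (and ψ χ)) (and (after o φ ψ) (after o φ χ)))
  | after_cbel (φ) : Red φ → Derivable pre Red φ

end Form

/-! ## Plausible public lying -/

/-- The operators `!` (truthful) and `¡` (lying) of plausible public announcement. -/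
inductive PubAct : Type
  | tell
  | lie

/-- Position in the plausibility order of the action model: `! ≺ ¡`. -/
def PubAct.rank : PubAct → ℕ
  | tell => 0
  | lie => 1

def PubAct.pre {L : Type v} (φ nφ : L) : PubAct → L
  | tell => φ
  | lie => nφ

theorem isPrewellorderOn_rank {X : Type u} (rank : X → ℕ) (S : Set X) :
    IsPrewellorderOn (fun x y => rank x ≤ rank y) S := by
  refine isPrewellorderOn_of_least (fun _ _ _ _ => le_total _ _)
    (fun _ _ _ _ _ _ => le_trans) (fun T _ hne => ?_)
  obtain ⟨m, hm, hmin⟩ := (measure rank).wf.has_min T hne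
  exact ⟨m, hm, fun x hx => not_lt.mp (hmin x hx)⟩

/-- Plausible public announcement with preconditions `φ` for `!` and `nφ` for `¡`: all agents
have universal access, and consider `!` more plausible than `¡`. -/
def publicAction {Agent : Type u} {L : Type v} (φ nφ : L) (x : PubAct) :
    PlausAction Agent L where
  Action := PubAct
  sim _ _ _ := True
  le _ y z := y.rank ≤ z.rank
  pre := PubAct.pre φ nφ
  sim_equiv _ := ⟨fun _ => trivial, fun _ => trivial, fun _ _ => trivial⟩
  le_prewellorder _ _ := isPrewellorderOn_rank _ _
  point := x

/-- The language of plausible public lying: `[! φ] ψ` is `after .tell φ ψ` and `[¡ φ] ψ` is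
`after .lie φ ψ`. -/
abbrev PublicForm (Agent Atom : Type u) : Type u := Form Agent Atom PubAct

section Public

variable {Agent Atom : Type u}

def publicSem (o : PubAct) (M : PlausModel Agent Atom) (P : Set M.State) :
    PlausAction Agent (Set M.State) :=
  publicAction P Pᶜ o

/-- Validity in the logic of plausible public lying. -/
def PublicValid (φ : PublicForm Agent Atom) : Prop := Form.Valid publicSem φ

def publicPre (o : PubAct) (φ : PublicForm Agent Atom) : PublicForm Agent Atom :=
  o.pre φ (.neg φ)

/-- Reduction axioms for conditional belief after a plausible public announcement:
`[x φ] Bₐ^χ ψ ↔ (pre x → (¬Kₐ¬⟨!φ⟩χ → Bₐ^{⟨!φ⟩χ} [!φ]ψ) ∧ (Kₐ¬⟨!φ⟩χ → Bₐ^{⟨¡φ⟩χ} [¡φ]ψ))`. -/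
inductive PublicReduction : PublicForm Agent Atom → Prop
  | mk (x : PubAct) (a : Agent) (φ χ ψ : PublicForm Agent Atom) :
    PublicReduction (.iff (.after x φ (.cbel a χ ψ)) (.imp (publicPre x φ)
      (.and
        (.imp (.neg (.know a (.neg (.dia .tell φ χ))))
          (.cbel a (.dia .tell φ χ) (.after .tell φ ψ)))
        (.imp (.know a (.neg (.dia .tell φ χ)))
          (.cbel a (.dia .lie φ χ) (.after .lie φ ψ))))))

/-- Derivability in the axiomatization of the logic of plausible public lying. -/
def PublicDerivable (φ : PublicForm Agent Atom) : Prop :=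
  Form.Derivable publicPre PublicReduction φ

/-- The preconditions in `publicSem` are the truth sets of the formulas `φ` and `¬φ`. -/
theorem publicSem_pre (o x : PubAct) (M : PlausModel Agent Atom)
    (φ : PublicForm Agent Atom) :
    (publicSem o M (Form.truth publicSem φ M)).pre x =
      Form.truth publicSem (publicPre x φ) M := by
  cases x <;> rfl

end Public

/-! ## Plausible agent lying -/

/-- The operators `!ₐ` (truthful), `¡!ₐ` (bluffing), and `¡ₐ` (lying) of plausible agent
announcement. -/
inductive AgentAct : Type
  | tell
  | bluff
  | lie

/-- Position in the plausibility order of the addressees: truthful before bluffing before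
lying. -/
def AgentAct.rank : AgentAct → ℕ
  | tell => 0
  | bluff => 1
  | lie => 2

def AgentAct.pre {L : Type v} (pTell pBluff pLie : L) : AgentAct → L
  | tell => pTell
  | bluff => pBluff
  | lie => pLie

/-- Plausible announcement by agent `a` with the given preconditions: `a` has identity access,
all other agents have universal access, and consider truthtelling more plausible than bluffing,
and bluffing more plausible than lying. (The order between the actions is immaterial for `a`, as
she distinguishes them.) -/
def agentAction {Agent : Type u} {L : Type v} (a : Agent) (pTell pBluff pLie : L)
    (x : AgentAct) : PlausAction Agent L where
  Action := AgentAct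
  sim b y z := b = a → y = z
  le _ y z := y.rank ≤ z.rank
  pre := AgentAct.pre pTell pBluff pLie
  sim_equiv _ := ⟨fun _ _ => rfl, fun h e => (h e).symm, fun h k e => (h e).trans (k e)⟩
  le_prewellorder _ _ := isPrewellorderOn_rank _ _
  point := x

/-- The language of plausible agent lying: `[!ₐ φ] ψ` is `after (a, tell) φ ψ`, and so on. -/
abbrev AgentForm (Agent Atom : Type u) : Type u := Form Agent Atom (Agent × AgentAct)

section Agent

variable {Agent Atom : Type u}

def agentSem (o : Agent × AgentAct) (M : PlausModel Agent Atom) (P : Set M.State) :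
    PlausAction Agent (Set M.State) :=
  agentAction o.1 (M.Bel o.1 P) (M.Bel o.1 P ∪ M.Bel o.1 Pᶜ)ᶜ (M.Bel o.1 Pᶜ) o.2

/-- Validity in the logic of plausible agent lying. -/
def AgentValid (φ : AgentForm Agent Atom) : Prop := Form.Valid agentSem φ

def agentPre (o : Agent × AgentAct) (φ : AgentForm Agent Atom) : AgentForm Agent Atom :=
  o.2.pre (.bel o.1 φ) (.neg (.or (.bel o.1 φ) (.bel o.1 (.neg φ)))) (.bel o.1 (.neg φ))

/-- Reduction axioms for conditional belief after a plausible announcement by `a`. For the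
speaker: `[xₐ φ] Bₐ^χ ψ ↔ (pre x → Bₐ^{⟨xₐφ⟩χ} [xₐφ]ψ)`. For an addressee `b`, whose beliefs
are determined by the most plausible one of the three actions that is, according to `b`'s
knowledge, possible with outcome `χ`. -/
inductive AgentReduction : AgentForm Agent Atom → Prop
  | speaker (a : Agent) (x : AgentAct) (φ χ ψ : AgentForm Agent Atom) :
    AgentReduction (.iff (.after (a, x) φ (.cbel a χ ψ)) (.imp (agentPre (a, x) φ)
      (.cbel a (.dia (a, x) φ χ) (.after (a, x) φ ψ))))
  | addressee (a b : Agent) (hab : b ≠ a) (x : AgentAct) (φ χ ψ : AgentForm Agent Atom) :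
    AgentReduction (.iff (.after (a, x) φ (.cbel b χ ψ)) (.imp (agentPre (a, x) φ)
      (.and
        (.imp (.neg (.know b (.neg (.dia (a, .tell) φ χ))))
          (.cbel b (.dia (a, .tell) φ χ) (.after (a, .tell) φ ψ)))
        (.and
          (.imp (.and (.know b (.neg (.dia (a, .tell) φ χ)))
              (.neg (.know b (.neg (.dia (a, .bluff) φ χ)))))
            (.cbel b (.dia (a, .bluff) φ χ) (.after (a, .bluff) φ ψ)))
          (.imp (.and (.know b (.neg (.dia (a, .tell) φ χ)))
              (.know b (.neg (.dia (a, .bluff) φ χ))))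
            (.cbel b (.dia (a, .lie) φ χ) (.after (a, .lie) φ ψ)))))))

/-- Derivability in the axiomatization of the logic of plausible agent lying. -/
def AgentDerivable (φ : AgentForm Agent Atom) : Prop :=
  Form.Derivable agentPre AgentReduction φ

/-- The preconditions in `agentSem` are the truth sets of the formulas `Bₐ φ`,
`¬(Bₐ φ ∨ Bₐ ¬φ)` and `Bₐ ¬φ`. -/
theorem agentSem_pre (a : Agent) (x y : AgentAct) (M : PlausModel Agent Atom)
    (φ : AgentForm Agent Atom) :
    (agentSem (a, x) M (Form.truth agentSem φ M)).pre y =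
      Form.truth agentSem (agentPre (a, y) φ) M := by
  cases y <;> simp [agentSem, agentAction, AgentAct.pre, agentPre, Form.truth, Form.or]

end Agent

end PlausLying

/-!
The two logics are treated uniformly, as instances of `Form.Derivable`.

*Soundness* (`Form.Derivable.valid`) is a check of each axiom. The axioms of conditional doxastic
logic use that every nonempty set of states in an epistemic class has most plausible elements
(for `Kₐφ ↔ Bₐ^{¬φ}φ`) and that plausibility is transitive (for minimality). Both kinds of
reduction axioms follow from `PlausModel.mem_cbel_update`: if the actions that an agent cannot
distinguish are strictly ordered, then by action priority the most plausible `χ`-states of the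
update are the most plausible `χ`-outcomes of the most plausible action that has a possible one.

*Completeness* is first reduced to the static language of atoms, `¬`, `∧` and conditional belief:
every formula is provably equivalent to a static one (`Form.Reducible.of_reductions`). Since the
reduction is sound, it suffices to falsify an underivable static formula in some model. The states
are the maximal consistent theories (`Form.World`); two of them are equivalent for `a` if they agree
on `a`'s conditional beliefs. A theory `w` determines, for every condition `χ`, the set `sel a χ w`
of theories that contain all `θ` with `Bₐ^χ θ ∈ w`; these should become the most plausible
`χ`-states, but the order that this suggests need not be well-founded. Only finitely many conditions
matter, however: `χ` and `χ ∧ ¬ψ` for the subformulas `Bₐ^χ ψ`. The conditions that are possible for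
`a` in `w` are totally preordered by comparative plausibility (`Form.World.condLe`: some member of
`sel a (χ ∨ χ') w` contains `χ`), which ranks the relevant ones by natural numbers, and a theory is
ranked by the least plausible relevant condition that it contains. Members of `sel a χ w` have at
most the rank of `χ` (`Form.World.sel.rank_le`), and all theories equivalent to `w` that contain `χ`
have at least that rank. If `Bₐ^χ ψ ∈ w`, then `χ ∧ ¬ψ` is strictly less plausible than `χ`, so that
no most plausible `χ`-state contains `¬ψ`; otherwise some member of `sel a χ w` contains `¬ψ`. This
gives the truth lemma `Form.IsStatic.mem_truth_canonicalModel`.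
-/

namespace PlausLying

/-! ### Conditional belief in models and in updates -/

namespace PlausModel

variable {Agent Atom : Type u} (M : PlausModel Agent Atom)

theorem know_eq_cbel (a : Agent) (P : Set M.State) : M.Know a P = M.CBel a Pᶜ P := by
  ext s
  refine ⟨fun h t ht => h t ht.1.1, fun h t ht => ?_⟩
  by_contra hP
  obtain ⟨m, hm, hmin⟩ := (M.le_prewellorder a s).exists_least
    {t | M.sim a s t ∧ t ∈ Pᶜ} (fun _ h => h.1) ⟨t, ht, hP⟩
  exact hm.2 (h m ⟨hm, fun t' h1 h2 => hmin t' ⟨h1, h2⟩⟩)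

theorem rCond_congr_of_sim {a : Agent} {s s' : M.State} (h : M.sim a s s') (C : Set M.State)
    (t : M.State) : M.RCond a C s t ↔ M.RCond a C s' t := by
  have key : ∀ t, M.sim a s t ↔ M.sim a s' t := fun t =>
    ⟨(M.sim_equiv a).trans ((M.sim_equiv a).symm h), (M.sim_equiv a).trans h⟩
  simp only [RCond, key]

theorem mem_cbel_congr_of_sim {a : Agent} {s s' : M.State} (h : M.sim a s s')
    (C P : Set M.State) : s ∈ M.CBel a C P ↔ s' ∈ M.CBel a C P := by
  simp only [CBel, Set.mem_ofPred_eq, M.rCond_congr_of_sim h]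

/-- If some most plausible `C`-state lies in `D`, then the most plausible `C ∩ D`-states are the
most plausible `C`-states that lie in `D`. -/
theorem rCond_inter {a : Agent} {s t₀ : M.State} {C D : Set M.State}
    (h : M.RCond a C s t₀) (hD : t₀ ∈ D) (t : M.State) :
    M.RCond a (C ∩ D) s t ↔ M.RCond a C s t ∧ t ∈ D := by
  constructor
  · rintro ⟨⟨hs, hC, htD⟩, hmin⟩
    refine ⟨⟨⟨hs, hC⟩, fun t' hs' hC' => ?_⟩, htD⟩
    exact (M.le_prewellorder a s).2.1 t hs t₀ h.1.1 t' hs'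
      (hmin t₀ h.1.1 ⟨h.1.2, hD⟩) (h.2 t' hs' hC')
  · rintro ⟨⟨⟨hs, hC⟩, hmin⟩, htD⟩
    exact ⟨⟨hs, hC, htD⟩, fun t' hs' hC' => hmin t' hs' hC'.1⟩

/-- Conditional belief in an update whose actions are strictly ordered by `rank`: what counts are
the `C`-outcomes of the most plausible action `β` that has an epistemically possible
`C`-outcome. -/
theorem mem_cbel_update (A : PlausActionModel Agent (Set M.State)) (rank : A.Action → ℕ)
    (hrank : Function.Injective rank) {a : Agent}
    (hle : ∀ α β, A.le a α β ↔ rank α ≤ rank β)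
    (C P : Set (M.update A).State) (s : M.State) (x : A.Action) (h : s ∈ A.pre x) :
    (⟨(s, x), h⟩ : (M.update A).State) ∈ (M.update A).CBel a C P ↔
      ∀ β, A.sim a x β →
        (∀ γ, A.sim a x γ → rank γ < rank β →
          ∀ t, M.sim a s t → ¬ ∃ h : t ∈ A.pre γ, (⟨(t, γ), h⟩ : (M.update A).State) ∈ C) →
        s ∈ M.CBel a {t | ∃ h : t ∈ A.pre β, (⟨(t, β), h⟩ : (M.update A).State) ∈ C}
          {t | ∀ h : t ∈ A.pre β, (⟨(t, β), h⟩ : (M.update A).State) ∈ P} := by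
  constructor
  · rintro H β hβ hlow t ⟨⟨hst, ht, htC⟩, hmin⟩ _
    refine H ⟨(t, β), ht⟩ ⟨⟨⟨hst, hβ⟩, htC⟩, ?_⟩
    rintro ⟨⟨t', γ⟩, ht'⟩ ⟨hst', hγ⟩ htC'
    rcases lt_trichotomy (rank γ) (rank β) with hlt | heq | hlt
    · exact absurd ⟨ht', htC'⟩ (hlow γ hγ hlt t' hst')
    · obtain rfl := hrank heq
      exact Or.inr ⟨⟨(hle _ _).2 le_rfl, (hle _ _).2 le_rfl⟩, hmin t' hst' ⟨ht', htC'⟩⟩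
    · exact Or.inl ⟨(hle _ _).2 hlt.le, fun hc => absurd ((hle _ _).1 hc) (not_le.2 hlt)⟩
  · rintro H ⟨⟨t, β⟩, ht⟩ ⟨⟨⟨hst, hβ⟩, htC⟩, hmin⟩
    have hmin' : ∀ t' γ (h' : t' ∈ A.pre γ), M.sim a s t' → A.sim a x γ →
        (⟨(t', γ), h'⟩ : (M.update A).State) ∈ C →
        actionPriority (A.le a) (M.le a) (t, β) (t', γ) :=
      fun t' γ h' h1 h2 h3 => hmin ⟨(t', γ), h'⟩ ⟨h1, h2⟩ h3
    refine H β hβ ?_ t ⟨⟨hst, ht, htC⟩, ?_⟩ ht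
    · rintro γ hγ hlt t' hst' ⟨ht', htC'⟩
      rcases hmin' t' γ ht' hst' hγ htC' with h1 | h1
      · exact absurd ((hle _ _).1 h1.1) (not_le.2 hlt)
      · exact absurd ((hle _ _).1 h1.1.1) (not_le.2 hlt)
    · rintro t' hst' ⟨ht', htC'⟩
      rcases hmin' t' β ht' hst' hβ htC' with h1 | h1
      · exact absurd h1.1 h1.2
      · exact h1.2

end PlausModel

/-! ### Soundness -/

namespace Form

variable {Agent Atom : Type u} {Op : Type v}
  {act : Op → (M : PlausModel Agent Atom) → Set M.State → PlausAction Agent (Set M.State)}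
  {M : PlausModel Agent Atom} {s : M.State}

theorem mem_truth_neg {φ : Form Agent Atom Op} :
    s ∈ truth act (neg φ) M ↔ s ∉ truth act φ M := Iff.rfl

theorem mem_truth_and {φ ψ : Form Agent Atom Op} :
    s ∈ truth act (and φ ψ) M ↔ s ∈ truth act φ M ∧ s ∈ truth act ψ M := Iff.rfl

theorem mem_truth_imp {φ ψ : Form Agent Atom Op} :
    s ∈ truth act (imp φ ψ) M ↔ (s ∈ truth act φ M → s ∈ truth act ψ M) := by
  simp only [imp, mem_truth_neg, mem_truth_and]; tauto

theorem mem_truth_iff {φ ψ : Form Agent Atom Op} :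
    s ∈ truth act (iff φ ψ) M ↔ (s ∈ truth act φ M ↔ s ∈ truth act ψ M) := by
  simp only [iff, mem_truth_and, mem_truth_imp]; tauto

theorem truth_cbel {a : Agent} {χ φ : Form Agent Atom Op} :
    truth act (cbel a χ φ) M = M.CBel a (truth act χ M) (truth act φ M) := rfl

/-- Truth of `[o φ] ψ`, with the action performed by `o` replaced by an equal one. -/
theorem mem_truth_after {o : Op} {φ ψ : Form Agent Atom Op}
    {A : PlausAction Agent (Set M.State)} (hA : act o M (truth act φ M) = A) :
    s ∈ truth act (after o φ ψ) M ↔ ∀ h : s ∈ A.pre A.point,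
      (⟨(s, A.point), h⟩ : (M.update A.toPlausActionModel).State) ∈
        truth act ψ (M.update A.toPlausActionModel) := by
  subst hA; rfl

theorem mem_truth_dia {o : Op} {φ ψ : Form Agent Atom Op}
    {A : PlausAction Agent (Set M.State)} (hA : act o M (truth act φ M) = A) :
    s ∈ truth act (dia o φ ψ) M ↔ ∃ h : s ∈ A.pre A.point,
      (⟨(s, A.point), h⟩ : (M.update A.toPlausActionModel).State) ∈
        truth act ψ (M.update A.toPlausActionModel) := by
  rw [dia, mem_truth_neg, mem_truth_after hA, not_forall]
  exact exists_congr fun h => not_not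

/-- The semantic content of the reduction axioms for conditional belief, for operators `op β` that
perform the actions `β` of one and the same action model, strictly ordered by `rank`. -/
theorem mem_truth_after_cbel {φ χ ψ : Form Agent Atom Op} {a : Agent}
    {A : PlausActionModel Agent (Set M.State)} (op : A.Action → Op)
    (hop : ∀ β, act (op β) M (truth act φ M) = ⟨A, β⟩) (rank : A.Action → ℕ)
    (hrank : Function.Injective rank) (hle : ∀ α β, A.le a α β ↔ rank α ≤ rank β)
    (x : A.Action) :
    s ∈ truth act (after (op x) φ (cbel a χ ψ)) M ↔ (s ∈ A.pre x → ∀ β, A.sim a x β →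
      (∀ γ, A.sim a x γ → rank γ < rank β → ∀ t, M.sim a s t →
        t ∉ truth act (dia (op γ) φ χ) M) →
      s ∈ truth act (cbel a (dia (op β) φ χ) (after (op β) φ ψ)) M) := by
  have hdia : ∀ β, truth act (dia (op β) φ χ) M =
      {t | ∃ h : t ∈ A.pre β,
        (⟨(t, β), h⟩ : (M.update A).State) ∈ truth act χ (M.update A)} :=
    fun β => Set.ext fun t => mem_truth_dia (hop β)
  have hafter : ∀ β, truth act (after (op β) φ ψ) M =
      {t | ∀ h : t ∈ A.pre β,
        (⟨(t, β), h⟩ : (M.update A).State) ∈ truth act ψ (M.update A)} :=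
    fun β => Set.ext fun t => mem_truth_after (hop β)
  rw [mem_truth_after (hop x)]
  refine forall_congr' fun h => ?_
  refine (M.mem_cbel_update A rank hrank hle (truth act χ _) (truth act ψ _) s x h).trans ?_
  simp only [truth_cbel, hdia, hafter]
  rfl

/-- Soundness of everything but the reduction axioms for conditional belief, for any operators
whose preconditions are expressed by `pre`. -/
theorem Derivable.valid {pre : Op → Form Agent Atom Op → Form Agent Atom Op}
    {Red : Form Agent Atom Op → Prop}
    (hpre : ∀ o φ (M : PlausModel Agent Atom),
      (act o M (truth act φ M)).pre (act o M (truth act φ M)).point = truth act (pre o φ) M)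
    (hRed : ∀ φ, Red φ → Valid act φ) {φ : Form Agent Atom Op}
    (h : Derivable pre Red φ) : Valid act φ := by
  induction h with
  | taut φ h =>
    exact fun M s => h (fun ψ => s ∈ truth act ψ M) (fun _ => Iff.rfl) (fun _ _ => Iff.rfl)
  | mp φ ψ _ _ h1 h2 => exact fun M s => mem_truth_imp.1 (h1 M s) (h2 M s)
  | cbel_nec a χ φ _ ih => exact fun M s t _ => ih M t
  | cbel_congr a χ χ' φ _ ih =>
    intro M s
    have : truth act χ M = truth act χ' M := Set.ext fun t => mem_truth_iff.1 (ih M t)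
    rw [mem_truth_iff]
    simp only [truth, this]
  | cbel_normal a χ φ ψ =>
    intro M s
    rw [mem_truth_imp, mem_truth_imp]
    exact fun h1 h2 t ht => mem_truth_imp.1 (h1 t ht) (h2 t ht)
  | bel_def a φ =>
    intro M s
    have : truth act (imp φ φ) M = Set.univ :=
      Set.eq_univ_of_forall fun t => mem_truth_imp.2 id
    rw [mem_truth_iff]
    simp [truth, this, PlausModel.Bel, PlausModel.CBel, PlausModel.R, PlausModel.RCond]
  | know_def a φ =>
    intro M s
    rw [mem_truth_iff]
    simp only [truth, M.know_eq_cbel]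
  | truthfulness a φ => exact fun M s => mem_truth_imp.2 fun h => h s ((M.sim_equiv a).refl s)
  | persistence a χ φ => exact fun M s => mem_truth_imp.2 fun h t ht => h t ht.1.1
  | pos_introspection a χ φ =>
    exact fun M s => mem_truth_imp.2 fun h t ht => (M.mem_cbel_congr_of_sim ht _ _).1 h
  | neg_introspection a χ φ =>
    exact fun M s => mem_truth_imp.2 fun h t ht h' => h ((M.mem_cbel_congr_of_sim ht _ _).2 h')
  | success a φ => exact fun M s t ht => ht.1.2
  | minimality a φ ψ χ =>
    intro M s
    rw [mem_truth_imp, mem_truth_iff, mem_truth_neg]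
    intro h
    obtain ⟨t₀, ht₀, hψ⟩ :
        ∃ t, M.RCond a (truth act φ M) s t ∧ t ∈ truth act ψ M := by
      by_contra hc
      exact h fun t ht ht' => hc ⟨t, ht, ht'⟩
    refine forall_congr' fun t => ?_
    rw [mem_truth_imp, ← and_imp]
    exact imp_congr (M.rCond_inter ht₀ hψ t) Iff.rfl
  | after_nec o φ ψ _ ih => exact fun M s h => ih _ _
  | after_normal o φ ψ χ =>
    intro M s
    rw [mem_truth_imp, mem_truth_imp]
    exact fun h1 h2 h => mem_truth_imp.1 (h1 h) (h2 h)
  | after_atom o φ p =>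
    intro M s
    rw [mem_truth_iff, mem_truth_imp, ← hpre]
    exact Iff.rfl
  | after_neg o φ ψ =>
    intro M s
    rw [mem_truth_iff, mem_truth_imp, ← hpre, mem_truth_neg, mem_truth_after rfl, mem_truth_after rfl]
    exact ⟨fun h hp hc => h hp (hc hp), fun h hp hc => h hp fun _ => hc⟩
  | after_and o φ ψ χ =>
    intro M s
    rw [mem_truth_iff, mem_truth_and]
    exact ⟨fun h => ⟨fun hp => (h hp).1, fun hp => (h hp).2⟩, fun h hp => ⟨h.1 hp, h.2 hp⟩⟩
  | after_cbel φ h => exact hRed φ h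

end Form

section Public

variable {Agent Atom : Type u}

theorem PubAct.rank_injective : Function.Injective PubAct.rank := by
  intro x y; cases x <;> cases y <;> simp [PubAct.rank]

theorem PublicReduction.valid {φ : PublicForm Agent Atom} (h : PublicReduction φ) :
    PublicValid φ := by
  obtain ⟨x, a, φ, χ, ψ⟩ := h
  intro M s
  rw [Form.mem_truth_iff, Form.mem_truth_imp, ← publicSem_pre x]
  refine (Form.mem_truth_after_cbel
    (A := (publicSem x M (Form.truth publicSem φ M)).toPlausActionModel) (fun β : PubAct => β)
    (fun β => rfl) PubAct.rank PubAct.rank_injective (fun _ _ => Iff.rfl) x).trans ?_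
  refine imp_congr Iff.rfl ?_
  have key : ∀ p q : PubAct → Prop,
      (∀ β : PubAct, True → (∀ γ : PubAct, True → γ.rank < β.rank → p γ) → q β) ↔
        q .tell ∧ (p .tell → q .lie) := by
    refine fun p q => ⟨fun h => ⟨h .tell trivial ?_, fun hp => h .lie trivial ?_⟩, ?_⟩
    · rintro (_ | _) _ hlt <;> simp [PubAct.rank] at hlt
    · rintro (_ | _) _ hlt
      · exact hp
      · simp [PubAct.rank] at hlt
    · rintro ⟨h1, h2⟩ (_ | _) _ hp
      · exact h1
      · exact h2 (hp .tell trivial (by simp [PubAct.rank]))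
  refine (key (fun γ => ∀ t, M.sim a s t → t ∉ Form.truth publicSem (.dia γ φ χ) M)
    (fun β => s ∈ Form.truth publicSem (.cbel a (.dia β φ χ) (.after β φ ψ)) M)).trans ?_
  have hK : ∀ γ : PubAct, s ∈ Form.truth publicSem (.know a (.neg (.dia γ φ χ))) M ↔
    ∀ t, M.sim a s t → t ∉ Form.truth publicSem (.dia γ φ χ) M := fun _ => Iff.rfl
  -- If an action has no possible `χ`-outcome, belief conditional on such outcomes is vacuous.
  have hvac : ∀ γ : PubAct, (∀ t, M.sim a s t → t ∉ Form.truth publicSem (.dia γ φ χ) M) →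
      s ∈ Form.truth publicSem (.cbel a (.dia γ φ χ) (.after γ φ ψ)) M :=
    fun γ h t ht => absurd ht.1.2 (h t ht.1.1)
  have prop : ∀ p q r : Prop, (p → q) → ((q ∧ (p → r)) ↔ ((¬p → q) ∧ (p → r))) :=
    fun p q r h => and_congr_left fun _ => ⟨fun hq _ => hq, fun hq => (em p).elim h hq⟩
  simp only [Form.mem_truth_and, Form.mem_truth_imp, Form.mem_truth_neg, hK]
  exact prop _ _ _ (hvac .tell)

theorem PublicDerivable.valid {φ : PublicForm Agent Atom} (h : PublicDerivable φ) :
    PublicValid φ :=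
  Form.Derivable.valid (fun o φ M => publicSem_pre o o M φ) (fun _ => PublicReduction.valid) h

end Public

section Agent

variable {Agent Atom : Type u}

theorem AgentAct.rank_injective : Function.Injective AgentAct.rank := by
  intro x y; cases x <;> cases y <;> simp [AgentAct.rank]

theorem AgentReduction.valid {φ : AgentForm Agent Atom} (h : AgentReduction φ) :
    AgentValid φ := by
  intro M s
  have red : ∀ (a b : Agent) (x : AgentAct) (φ χ ψ : AgentForm Agent Atom),
      s ∈ Form.truth agentSem (.after (a, x) φ (.cbel b χ ψ)) M ↔
        (s ∈ Form.truth agentSem (agentPre (a, x) φ) M →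
          ∀ β : AgentAct, (b = a → x = β) → (∀ γ : AgentAct, (b = a → x = γ) →
            γ.rank < β.rank → s ∈ Form.truth agentSem (.know b (.neg (.dia (a, γ) φ χ))) M) →
          s ∈ Form.truth agentSem (.cbel b (.dia (a, β) φ χ) (.after (a, β) φ ψ)) M) := by
    intro a b x φ χ ψ
    rw [← agentSem_pre a x x]
    exact Form.mem_truth_after_cbel
      (A := (agentSem (a, x) M (Form.truth agentSem φ M)).toPlausActionModel)
      (fun β : AgentAct => (a, β)) (fun β => rfl) AgentAct.rank AgentAct.rank_injective
      (fun _ _ => Iff.rfl) x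
  obtain ⟨a, x, φ, χ, ψ⟩ | ⟨a, b, hab, x, φ, χ, ψ⟩ := h
  · rw [Form.mem_truth_iff, Form.mem_truth_imp, red]
    refine imp_congr Iff.rfl ⟨fun h => h x (fun _ => rfl) ?_, ?_⟩
    · rintro γ hγ hlt
      exact absurd hlt (by rw [hγ rfl]; exact lt_irrefl _)
    · rintro h β hβ -
      obtain rfl := hβ rfl
      exact h
  · rw [Form.mem_truth_iff, Form.mem_truth_imp, red]
    refine imp_congr Iff.rfl ?_
    have key : ∀ p q : AgentAct → Prop,
        (∀ β : AgentAct, (b = a → x = β) →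
          (∀ γ : AgentAct, (b = a → x = γ) → γ.rank < β.rank → p γ) → q β) ↔
        q .tell ∧ (p .tell → q .bluff) ∧ (p .tell ∧ p .bluff → q .lie) := by
      intro p q
      constructor
      · intro h
        refine ⟨h .tell (absurd · hab) ?_, fun hp => h .bluff (absurd · hab) ?_,
          fun hp => h .lie (absurd · hab) ?_⟩ <;>
        rintro (_ | _ | _) _ hlt <;>
        first
          | exact absurd hlt (by decide)
          | exact hp
          | exact hp.1
          | exact hp.2
      · rintro ⟨h1, h2, h3⟩ (_ | _ | _) _ hp
        · exact h1
        · exact h2 (hp .tell (absurd · hab) (by simp [AgentAct.rank]))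
        · exact h3 ⟨hp .tell (absurd · hab) (by simp [AgentAct.rank]),
            hp .bluff (absurd · hab) (by simp [AgentAct.rank])⟩
    refine (key (fun γ => s ∈ Form.truth agentSem (.know b (.neg (.dia (a, γ) φ χ))) M)
      (fun β => s ∈ Form.truth agentSem (.cbel b (.dia (a, β) φ χ) (.after (a, β) φ ψ)) M)).trans
      ?_
    -- If an action has no possible `χ`-outcome, belief conditional on such outcomes is vacuous.
    have hvac : ∀ γ : AgentAct,
        s ∈ Form.truth agentSem (.know b (.neg (.dia (a, γ) φ χ))) M →
        s ∈ Form.truth agentSem (.cbel b (.dia (a, γ) φ χ) (.after (a, γ) φ ψ)) M :=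
      fun γ h t ht => absurd ht.1.2 (h t ht.1.1)
    have h1 := hvac .tell
    have h2 := hvac .bluff
    have prop : ∀ p₀ p₁ q₀ q₁ q₂ : Prop, (p₀ → q₀) → (p₁ → q₁) →
        ((q₀ ∧ (p₀ → q₁) ∧ (p₀ ∧ p₁ → q₂)) ↔
          ((¬p₀ → q₀) ∧ (p₀ ∧ ¬p₁ → q₁) ∧ (p₀ ∧ p₁ → q₂))) := by
      intro p₀ p₁ q₀ q₁ q₂ h h'
      exact ⟨fun H => ⟨fun _ => H.1, fun hp => H.2.1 hp.1, H.2.2⟩,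
        fun H => ⟨(em p₀).elim h H.1,
          fun hp => (em p₁).elim h' fun hp' => H.2.1 ⟨hp, hp'⟩, H.2.2⟩⟩
    simp only [Form.mem_truth_and, Form.mem_truth_imp, Form.mem_truth_neg]
    exact prop _ _ _ _ _ h1 h2

theorem AgentDerivable.valid {φ : AgentForm Agent Atom} (h : AgentDerivable φ) :
    AgentValid φ :=
  Form.Derivable.valid (fun o φ M => agentSem_pre o.1 o.2 o.2 M φ)
    (fun _ => AgentReduction.valid) h

end Agent

namespace Form

/-! ### Maximal consistent theories -/

variable {Agent Atom : Type u} {Op : Type v} {pre : Op → Form Agent Atom Op → Form Agent Atom Op}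
  {Red : Form Agent Atom Op → Prop}

/-- Sets of formulas that contain all derivable formulas and are closed under modus ponens. -/
structure IsTheory (pre : Op → Form Agent Atom Op → Form Agent Atom Op)
    (Red : Form Agent Atom Op → Prop) (T : Set (Form Agent Atom Op)) : Prop where
  derivable_mem : ∀ φ, Derivable pre Red φ → φ ∈ T
  mp_mem : ∀ φ ψ, imp φ ψ ∈ T → φ ∈ T → ψ ∈ T

/-- Maximal consistent theories: theories that contain exactly one of `φ` and `¬φ`, for every
formula `φ`. -/
structure World (pre : Op → Form Agent Atom Op → Form Agent Atom Op)
    (Red : Form Agent Atom Op → Prop) where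
  carrier : Set (Form Agent Atom Op)
  isTheory : IsTheory pre Red carrier
  neg_mem_carrier : ∀ φ, neg φ ∈ carrier ↔ φ ∉ carrier

instance : Membership (Form Agent Atom Op) (World pre Red) := ⟨fun w φ => φ ∈ w.carrier⟩

namespace World

theorem derivable_mem (w : World pre Red) {φ : Form Agent Atom Op} (h : Derivable pre Red φ) :
    φ ∈ w := w.isTheory.derivable_mem φ h

theorem neg_mem {w : World pre Red} {φ : Form Agent Atom Op} : neg φ ∈ w ↔ φ ∉ w :=
  w.neg_mem_carrier φ

theorem mp_mem {w : World pre Red} {φ ψ : Form Agent Atom Op} (h : imp φ ψ ∈ w) (h' : φ ∈ w) :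
    ψ ∈ w := w.isTheory.mp_mem φ ψ h h'

theorem and_mem {w : World pre Red} {φ ψ : Form Agent Atom Op} :
    and φ ψ ∈ w ↔ φ ∈ w ∧ ψ ∈ w := by
  refine ⟨fun h => ⟨mp_mem (w.derivable_mem (.taut _ ?_)) h,
    mp_mem (w.derivable_mem (.taut _ ?_)) h⟩, fun h => mp_mem (mp_mem
      (w.derivable_mem (.taut (imp φ (imp ψ (and φ ψ))) ?_)) h.1) h.2⟩ <;>
  · intro v hn ha
    simp only [imp, hn, ha]
    tauto

theorem imp_mem {w : World pre Red} {φ ψ : Form Agent Atom Op} :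
    imp φ ψ ∈ w ↔ (φ ∈ w → ψ ∈ w) := by
  simp only [imp, neg_mem, and_mem]; tauto

theorem iff_mem {w : World pre Red} {φ ψ : Form Agent Atom Op} :
    iff φ ψ ∈ w ↔ (φ ∈ w ↔ ψ ∈ w) := by
  simp only [iff, imp_mem, and_mem]; tauto

theorem or_mem {w : World pre Red} {φ ψ : Form Agent Atom Op} :
    or φ ψ ∈ w ↔ φ ∈ w ∨ ψ ∈ w := by
  simp only [or, neg_mem, and_mem]; tauto

theorem iff_of_derivable (w : World pre Red) {φ ψ : Form Agent Atom Op}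
    (h : Derivable pre Red (iff φ ψ)) : φ ∈ w ↔ ψ ∈ w := iff_mem.1 (w.derivable_mem h)

end World

/-- Lindenbaum's lemma, by Zorn's lemma for the theories that extend `T` and omit `ψ`. -/
theorem IsTheory.exists_world {T : Set (Form Agent Atom Op)} (hT : IsTheory pre Red T)
    {ψ : Form Agent Atom Op} (hψ : ψ ∉ T) :
    ∃ w : World pre Red, (∀ φ ∈ T, φ ∈ w) ∧ ψ ∉ w := by
  obtain ⟨T', hTT', hmax⟩ := zorn_subset_nonempty {T | IsTheory pre Red T ∧ ψ ∉ T} (by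
    intro c hc hchain hne
    refine ⟨⋃₀ c, ⟨⟨fun φ h => ?_, ?_⟩, ?_⟩, fun s hs => Set.subset_sUnion_of_mem hs⟩
    · obtain ⟨s, hs⟩ := hne
      exact ⟨s, hs, (hc hs).1.derivable_mem φ h⟩
    · rintro φ χ ⟨s, hs, h⟩ ⟨t, ht, h'⟩
      rcases hchain.total hs ht with hst | hst
      · exact ⟨t, ht, (hc ht).1.mp_mem φ χ (hst h) h'⟩
      · exact ⟨s, hs, (hc hs).1.mp_mem φ χ h (hst h')⟩
    · rintro ⟨s, hs, h⟩
      exact (hc hs).2 h) T ⟨hT, hψ⟩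
  have hT' := hmax.prop.1
  have hψ' := hmax.prop.2
  have taut : ∀ {φ}, IsTautology φ → φ ∈ T' := fun h => hT'.derivable_mem _ (.taut _ h)
  -- By maximality, adding a formula to `T'` makes `ψ` a consequence.
  have himp : ∀ θ, θ ∉ T' → imp θ ψ ∈ T' := by
    intro θ hθ
    by_contra hc
    refine hθ (hmax.le_of_ge (y := {η | imp θ η ∈ T'}) ⟨⟨fun φ h => ?_, fun φ χ h1 h2 => ?_⟩, hc⟩
      (fun φ h => ?_) ?_)
    · refine hT'.mp_mem φ _ (taut ?_) (hT'.derivable_mem φ h)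
      intro v hn ha; simp only [imp, hn, ha]; tauto
    · refine hT'.mp_mem _ _ (hT'.mp_mem _ _ (taut ?_) h1) h2
      intro v hn ha; simp only [imp, hn, ha]; tauto
    · refine hT'.mp_mem φ _ (taut ?_) h
      intro v hn ha; simp only [imp, hn, ha]; tauto
    · refine taut ?_
      intro v hn ha; simp only [imp, hn, ha]; tauto
  refine ⟨⟨T', hT', fun θ => ⟨fun h h' => hψ' ?_, fun h => ?_⟩⟩, fun φ h => hTT' h, hψ'⟩
  · refine hT'.mp_mem _ _ (hT'.mp_mem _ _ (taut ?_) h) h'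
    intro v hn ha; simp only [imp, hn, ha]; tauto
  · by_contra h'
    refine hψ' (hT'.mp_mem _ _ (hT'.mp_mem _ _ (taut ?_) (himp _ h)) (himp _ h'))
    intro v hn ha; simp only [imp, hn, ha]; tauto

theorem derivable_iff_forall_world {φ : Form Agent Atom Op} :
    Derivable pre Red φ ↔ ∀ w : World pre Red, φ ∈ w := by
  refine ⟨fun h w => w.derivable_mem h, fun h => ?_⟩
  by_contra hφ
  obtain ⟨w, -, hw⟩ := IsTheory.exists_world (pre := pre) (Red := Red)
    (T := {φ | Derivable pre Red φ}) ⟨fun _ h => h, fun φ ψ => .mp φ ψ⟩ hφ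
  exact hw (h w)

/-! ### Reduction to the static language -/

/-- Formulas built from atoms by `¬`, `∧` and conditional belief. -/
inductive IsStatic : Form Agent Atom Op → Prop
  | atom (p) : IsStatic (atom p)
  | neg (φ) : IsStatic φ → IsStatic (neg φ)
  | and (φ ψ) : IsStatic φ → IsStatic ψ → IsStatic (and φ ψ)
  | cbel (a χ φ) : IsStatic χ → IsStatic φ → IsStatic (cbel a χ φ)

/-- Formulas that are provably equivalent to a static one. -/
def Reducible (pre : Op → Form Agent Atom Op → Form Agent Atom Op)
    (Red : Form Agent Atom Op → Prop) (φ : Form Agent Atom Op) : Prop :=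
  ∃ φ', IsStatic φ' ∧ Derivable pre Red (iff φ φ')

theorem Derivable.iff_of_forall_world {φ ψ : Form Agent Atom Op}
    (h : ∀ w : World pre Red, φ ∈ w ↔ ψ ∈ w) : Derivable pre Red (iff φ ψ) :=
  derivable_iff_forall_world.2 fun w => World.iff_mem.2 (h w)

theorem World.mem_cbel_congr (w : World pre Red) {a : Agent} {χ χ' φ φ' : Form Agent Atom Op}
    (h : Derivable pre Red (iff χ χ')) (h' : Derivable pre Red (iff φ φ')) :
    cbel a χ φ ∈ w ↔ cbel a χ' φ' ∈ w := by
  have mono : ∀ φ φ' : Form Agent Atom Op, (∀ w : World pre Red, φ ∈ w ↔ φ' ∈ w) →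
      cbel a χ' φ ∈ w → cbel a χ' φ' ∈ w := fun φ φ' h hw =>
    mp_mem (mp_mem (w.derivable_mem (.cbel_normal a χ' φ φ')) (w.derivable_mem
      (.cbel_nec a χ' _ (derivable_iff_forall_world.2 fun w => imp_mem.2 (h w).1)))) hw
  rw [w.iff_of_derivable (.cbel_congr a χ χ' φ h)]
  exact ⟨mono _ _ fun w => w.iff_of_derivable h', mono _ _ fun w => (w.iff_of_derivable h').symm⟩

theorem World.mem_after_congr (w : World pre Red) {o : Op} {φ ψ ψ' : Form Agent Atom Op}
    (h : Derivable pre Red (iff ψ ψ')) : after o φ ψ ∈ w ↔ after o φ ψ' ∈ w := by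
  have mono : ∀ ψ ψ' : Form Agent Atom Op, (∀ w : World pre Red, ψ ∈ w ↔ ψ' ∈ w) →
      after o φ ψ ∈ w → after o φ ψ' ∈ w := fun ψ ψ' h hw =>
    mp_mem (mp_mem (w.derivable_mem (.after_normal o φ ψ ψ')) (w.derivable_mem
      (.after_nec o φ _ (derivable_iff_forall_world.2 fun w => imp_mem.2 (h w).1)))) hw
  exact ⟨mono _ _ fun w => w.iff_of_derivable h, mono _ _ fun w => (w.iff_of_derivable h).symm⟩

namespace Reducible

variable {φ ψ χ : Form Agent Atom Op} {a : Agent} {o : Op}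

theorem of_iff (h : ∀ w : World pre Red, φ ∈ w ↔ ψ ∈ w) (hψ : Reducible pre Red ψ) :
    Reducible pre Red φ := by
  obtain ⟨ψ', hs, hd⟩ := hψ
  exact ⟨ψ', hs, .iff_of_forall_world fun w => (h w).trans (w.iff_of_derivable hd)⟩

theorem of_derivable (h : Derivable pre Red (iff φ ψ)) (hψ : Reducible pre Red ψ) :
    Reducible pre Red φ := hψ.of_iff fun w => w.iff_of_derivable h

theorem of_isStatic (h : IsStatic φ) : Reducible pre Red φ :=
  ⟨φ, h, .iff_of_forall_world fun _ => Iff.rfl⟩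

theorem neg (h : Reducible pre Red φ) : Reducible pre Red (neg φ) := by
  obtain ⟨φ', hs, hd⟩ := h
  exact ⟨_, .neg φ' hs, .iff_of_forall_world fun w => by
    rw [World.neg_mem, World.neg_mem, w.iff_of_derivable hd]⟩

theorem and (hφ : Reducible pre Red φ) (hψ : Reducible pre Red ψ) :
    Reducible pre Red (and φ ψ) := by
  obtain ⟨φ', hs, hd⟩ := hφ
  obtain ⟨ψ', hs', hd'⟩ := hψ
  exact ⟨_, .and φ' ψ' hs hs', .iff_of_forall_world fun w => by
    rw [World.and_mem, World.and_mem, w.iff_of_derivable hd, w.iff_of_derivable hd']⟩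

theorem cbel (hχ : Reducible pre Red χ) (hφ : Reducible pre Red φ) :
    Reducible pre Red (cbel a χ φ) := by
  obtain ⟨χ', hs, hd⟩ := hχ
  obtain ⟨φ', hs', hd'⟩ := hφ
  exact ⟨_, .cbel a χ' φ' hs hs', .iff_of_forall_world fun w => w.mem_cbel_congr hd hd'⟩

theorem imp (hφ : Reducible pre Red φ) (hψ : Reducible pre Red ψ) :
    Reducible pre Red (imp φ ψ) := (hφ.and hψ.neg).neg

theorem or (hφ : Reducible pre Red φ) (hψ : Reducible pre Red ψ) :
    Reducible pre Red (or φ ψ) := (hφ.neg.and hψ.neg).neg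

theorem know (h : Reducible pre Red φ) : Reducible pre Red (know a φ) :=
  .of_derivable (.know_def a φ) (.cbel h.neg h)

theorem bel (h : Reducible pre Red φ) : Reducible pre Red (bel a φ) :=
  .of_derivable (.bel_def a φ) (.cbel (h.imp h) h)

theorem after_neg (hpre : Reducible pre Red (pre o φ)) (h : Reducible pre Red (after o φ ψ)) :
    Reducible pre Red (after o φ (.neg ψ)) :=
  .of_derivable (.after_neg o φ ψ) (hpre.imp h.neg)

theorem dia (hpre : Reducible pre Red (pre o φ)) (h : Reducible pre Red (after o φ ψ)) :
    Reducible pre Red (dia o φ ψ) := (after_neg hpre h).neg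

/-- If preconditions and conditional beliefs after announcements can be reduced, then all formulas
can. Operators are eliminated from the inside out, by `World.mem_after_congr`; there is no
congruence rule for the announced formula, but none is needed, as it survives in the reduction
axioms only in the precondition and in operators applied to simpler formulas. -/
theorem of_reductions
    (hpre : ∀ o φ, Reducible pre Red φ → Reducible pre Red (pre o φ))
    (hcbel : ∀ o φ a χ ψ, Reducible pre Red φ → (∀ o, Reducible pre Red (after o φ χ)) →
      (∀ o, Reducible pre Red (after o φ ψ)) → Reducible pre Red (after o φ (.cbel a χ ψ)))
    (φ : Form Agent Atom Op) : Reducible pre Red φ := by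
  have hafter : ∀ φ, Reducible pre Red φ → ∀ ψ, IsStatic ψ → ∀ o,
      Reducible pre Red (after o φ ψ) := by
    intro φ hφ ψ hψ
    induction hψ with
    | atom p =>
      exact fun o => .of_derivable (.after_atom o φ p) ((hpre o φ hφ).imp (.of_isStatic (.atom p)))
    | neg ψ _ ih => exact fun o => after_neg (hpre o φ hφ) (ih o)
    | and ψ χ _ _ ih ih' =>
      exact fun o => .of_derivable (.after_and o φ ψ χ) ((ih o).and (ih' o))
    | cbel a χ ψ _ _ ih ih' => exact fun o => hcbel o φ a χ ψ hφ ih ih'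
  induction φ with
  | atom p => exact .of_isStatic (.atom p)
  | neg φ ih => exact ih.neg
  | and φ ψ ih ih' => exact ih.and ih'
  | bel a φ ih => exact ih.bel
  | know a φ ih => exact ih.know
  | cbel a χ φ ih ih' => exact ih.cbel ih'
  | after o φ ψ ih ih' =>
    obtain ⟨ψ', hs, hd⟩ := ih'
    exact .of_iff (fun w => w.mem_after_congr hd) (hafter φ ih ψ' hs o)

end Reducible

end Form

theorem PublicForm.reducible {Agent Atom : Type u} (φ : PublicForm Agent Atom) :
    Form.Reducible publicPre PublicReduction φ := by
  have hpre : ∀ o (φ : PublicForm Agent Atom), Form.Reducible publicPre PublicReduction φ →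
      Form.Reducible publicPre PublicReduction (publicPre o φ) := by
    rintro (_ | _) φ h
    · exact h
    · exact h.neg
  refine Form.Reducible.of_reductions hpre (fun o φ a χ ψ hφ hχ hψ => ?_) φ
  have hd : ∀ x, Form.Reducible publicPre PublicReduction (.dia x φ χ) :=
    fun x => .dia (hpre x φ hφ) (hχ x)
  exact .of_derivable (.after_cbel _ (.mk o a φ χ ψ)) (.imp (hpre o φ hφ)
    (.and (.imp (hd _).neg.know.neg (.cbel (hd _) (hψ _)))
      (.imp (hd _).neg.know (.cbel (hd _) (hψ _)))))

theorem AgentForm.reducible {Agent Atom : Type u} (φ : AgentForm Agent Atom) :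
    Form.Reducible agentPre AgentReduction φ := by
  have hpre : ∀ o (φ : AgentForm Agent Atom), Form.Reducible agentPre AgentReduction φ →
      Form.Reducible agentPre AgentReduction (agentPre o φ) := by
    rintro ⟨a, _ | _ | _⟩ φ h
    · exact h.bel
    · exact (h.bel.or h.neg.bel).neg
    · exact h.neg.bel
  refine Form.Reducible.of_reductions hpre (fun o φ b χ ψ hφ hχ hψ => ?_) φ
  obtain ⟨a, x⟩ := o
  have hd : ∀ x, Form.Reducible agentPre AgentReduction (.dia (a, x) φ χ) :=
    fun x => .dia (hpre (a, x) φ hφ) (hχ (a, x))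
  have hc : ∀ x, Form.Reducible agentPre AgentReduction
      (.cbel b (.dia (a, x) φ χ) (.after (a, x) φ ψ)) := fun x => .cbel (hd x) (hψ (a, x))
  have hk : ∀ x, Form.Reducible agentPre AgentReduction (.know b (.neg (.dia (a, x) φ χ))) :=
    fun x => (hd x).neg.know
  by_cases hab : b = a
  · subst hab
    exact .of_derivable (.after_cbel _ (.speaker b x φ χ ψ)) (.imp (hpre _ φ hφ) (hc x))
  · exact .of_derivable (.after_cbel _ (.addressee a b hab x φ χ ψ)) (.imp (hpre _ φ hφ)
      (.and (.imp (hk _).neg (hc _)) (.and (.imp ((hk _).and (hk _).neg) (hc _))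
        (.imp ((hk _).and (hk _)) (hc _)))))

/-! ### The canonical model for a finite set of conditions -/

namespace Form

variable {Agent Atom : Type u} {Op : Type v} {pre : Op → Form Agent Atom Op → Form Agent Atom Op}
  {Red : Form Agent Atom Op → Prop}

namespace World

variable {a : Agent} {w w' v v' u : World pre Red} {χ χ' χ'' ψ : Form Agent Atom Op}

/-- Canonical epistemic equivalence: agreement on the conditional beliefs of `a`. -/
def sim (a : Agent) (w v : World pre Red) : Prop := ∀ χ ψ, cbel a χ ψ ∈ w ↔ cbel a χ ψ ∈ v

/-- Canonical accessibility for belief conditional on `χ`. In a model where truth is membership,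
these would be the most plausible `χ`-states. -/
def sel (a : Agent) (χ : Form Agent Atom Op) (w v : World pre Red) : Prop :=
  ∀ θ, cbel a χ θ ∈ w → θ ∈ v

theorem sim_equivalence (a : Agent) : Equivalence (sim (pre := pre) (Red := Red) a) :=
  ⟨fun _ _ _ => Iff.rfl, fun h χ ψ => (h χ ψ).symm, fun h k χ ψ => (h χ ψ).trans (k χ ψ)⟩

theorem sel_congr_of_sim (h : sim a w w') : sel a χ w v ↔ sel a χ w' v :=
  forall_congr' fun θ => imp_congr (h χ θ) Iff.rfl

theorem sel.mem (h : sel a χ w v) : χ ∈ v := h χ (w.derivable_mem (.success a χ))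

theorem sel.sim (h : sel a χ w v) : sim a w v := by
  have hK : ∀ θ, know a θ ∈ w → θ ∈ v := fun θ hθ =>
    h θ (mp_mem (w.derivable_mem (.persistence a χ θ)) hθ)
  refine fun χ' θ => ⟨fun hθ => hK _ (mp_mem (w.derivable_mem (.pos_introspection a χ' θ)) hθ),
    fun hθ => ?_⟩
  by_contra hc
  exact neg_mem.1 (hK _ (mp_mem (w.derivable_mem (.neg_introspection a χ' θ))
    (neg_mem.2 hc))) hθ

theorem cbel_mem_iff : cbel a χ ψ ∈ w ↔ ∀ v, sel a χ w v → ψ ∈ v := by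
  refine ⟨fun h v hv => hv ψ h, fun h => ?_⟩
  by_contra hψ
  obtain ⟨v, hv, hψv⟩ := IsTheory.exists_world (pre := pre) (Red := Red)
    (T := {θ | cbel a χ θ ∈ w}) ⟨fun θ hθ => w.derivable_mem (.cbel_nec a χ θ hθ),
      fun φ θ h1 h2 => mp_mem (mp_mem (w.derivable_mem (.cbel_normal a χ φ θ)) h1) h2⟩ hψ
  exact hψv (h v hv)

theorem exists_sel (h : sim a w v) (hχ : χ ∈ v) : ∃ u, sel a χ w u := by
  by_contra hc
  have h1 : cbel a χ (neg χ) ∈ w := cbel_mem_iff.2 fun u hu => absurd ⟨u, hu⟩ hc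
  have h2 : cbel a (neg (neg χ)) (neg χ) ∈ v :=
    (v.mem_cbel_congr (.iff_of_forall_world fun w => by simp only [neg_mem, not_not])
      (.iff_of_forall_world fun w => Iff.rfl)).1 ((h _ _).1 h1)
  have h3 := (v.iff_of_derivable (.know_def a (neg χ))).2 h2
  exact neg_mem.1 (mp_mem (v.derivable_mem (.truthfulness a (neg χ))) h3) hχ

/-- The canonical counterpart of `PlausModel.rCond_inter`, which is what the axiom of minimality
says. -/
theorem sel_restrict (himp : ∀ u : World pre Red, ψ ∈ u → χ ∈ u) (h : sel a χ w v) (hψ : ψ ∈ v) :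
    sel a ψ w u ↔ sel a χ w u ∧ ψ ∈ u := by
  have hmin : ∀ θ, cbel a ψ θ ∈ w ↔ cbel a χ (imp ψ θ) ∈ w := by
    intro θ
    rw [w.mem_cbel_congr (χ' := and χ ψ) (φ' := θ)
      (.iff_of_forall_world fun u => by rw [and_mem]; exact ⟨fun h => ⟨himp u h, h⟩, And.right⟩)
      (.iff_of_forall_world fun _ => Iff.rfl)]
    refine iff_mem.1 (mp_mem (w.derivable_mem (.minimality a χ ψ θ)) (neg_mem.2 fun hc => ?_))
    exact neg_mem.1 (h _ hc) hψ
  constructor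
  · refine fun hu => ⟨fun θ hθ => hu θ ((hmin θ).2 (cbel_mem_iff.2 fun v hv => ?_)), hu.mem⟩
    exact imp_mem.2 fun _ => hv θ hθ
  · exact fun hu θ hθ => imp_mem.1 (hu.1 _ ((hmin θ).1 hθ)) hu.2

/-- Comparative plausibility of conditions: some most plausible `χ ∨ χ'`-state satisfies `χ`. -/
def condLe (a : Agent) (w : World pre Red) (χ χ' : Form Agent Atom Op) : Prop :=
  ∃ v, sel a (or χ χ') w v ∧ χ ∈ v

theorem condLe_total (hv : sim a w v) (h : χ ∈ v) : condLe a w χ χ' ∨ condLe a w χ' χ := by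
  obtain ⟨u, hu⟩ := exists_sel (χ := or χ χ') hv (or_mem.2 (.inl h))
  rcases or_mem.1 hu.mem with h1 | h1
  · exact .inl ⟨u, hu, h1⟩
  · refine .inr ⟨u, fun θ hθ => hu θ ((w.mem_cbel_congr (.iff_of_forall_world fun w => ?_)
      (.iff_of_forall_world fun _ => Iff.rfl)).1 hθ), h1⟩
    rw [or_mem, or_mem, or_comm]

theorem condLe_refl (hv : sim a w v) (h : χ ∈ v) : condLe a w χ χ :=
  (condLe_total hv h).elim id id

theorem condLe_trans (h : condLe a w χ χ') (h' : condLe a w χ' χ'') : condLe a w χ χ'' := by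
  obtain ⟨v, hv, hχ⟩ := h
  obtain ⟨v', hv', hχ'⟩ := h'
  let δ := or χ (or χ' χ'')
  have hδ : ∀ u : World pre Red, δ ∈ u ↔ χ ∈ u ∨ χ' ∈ u ∨ χ'' ∈ u := fun u => by
    simp only [δ, or_mem]
  have himp : ∀ u : World pre Red, or χ χ' ∈ u → δ ∈ u := fun u => by rw [or_mem, hδ]; tauto
  have himp' : ∀ u : World pre Red, or χ' χ'' ∈ u → δ ∈ u := fun u => by rw [or_mem, hδ]; tauto
  have himp'' : ∀ u : World pre Red, or χ χ'' ∈ u → δ ∈ u := fun u => by rw [or_mem, hδ]; tauto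
  -- Some most plausible `δ`-state satisfies one of the disjuncts; by `h'` and `h`, if one satisfies
  -- `χ''` then one satisfies `χ'`, and if one satisfies `χ'` then one satisfies `χ`.
  have of_mem : ∀ u, sel a δ w u → χ ∈ u → condLe a w χ χ'' := fun u hu h =>
    ⟨u, (sel_restrict himp'' hu (or_mem.2 (.inl h))).2 ⟨hu, or_mem.2 (.inl h)⟩, h⟩
  have of_mem' : ∀ u, sel a δ w u → χ' ∈ u → condLe a w χ χ'' := fun u hu h =>
    of_mem v ((sel_restrict himp hu (or_mem.2 (.inr h))).1 hv).1 hχ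
  obtain ⟨u, hu⟩ := exists_sel (χ := δ) hv.sim ((hδ v).2 (.inl hχ))
  rcases (hδ u).1 hu.mem with h | h | h
  · exact of_mem u hu h
  · exact of_mem' u hu h
  · exact of_mem' v' ((sel_restrict himp' hu (or_mem.2 (.inr h))).1 hv').1 hχ'

theorem condLe_congr_of_sim (h : sim a w w') : condLe a w χ χ' ↔ condLe a w' χ χ' :=
  exists_congr fun _ => and_congr (sel_congr_of_sim h) Iff.rfl

open Classical in
/-- The height of `χ` in the comparative plausibility order: the number of conditions in `D` that
are more plausible than `χ`. -/
noncomputable def condRank (D : Finset (Form Agent Atom Op)) (a : Agent) (w : World pre Red)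
    (χ : Form Agent Atom Op) : ℕ := (D.filter fun χ' => ¬ condLe a w χ χ').card

open Classical in
/-- The implausibility of a world is that of the least plausible condition in `D` that it
satisfies. -/
noncomputable def rank (D : Finset (Form Agent Atom Op)) (a : Agent) (w : World pre Red) : ℕ :=
  (D.filter fun χ => χ ∈ w).sup (condRank D a w)

variable {D : Finset (Form Agent Atom Op)}

theorem condRank_congr_of_sim (h : sim a w w') : condRank D a w χ = condRank D a w' χ := by
  unfold condRank
  congr 1
  ext ξ
  simp only [Finset.mem_filter, condLe_congr_of_sim h]

theorem condRank_le_of_condLe (h : condLe a w χ χ') : condRank D a w χ ≤ condRank D a w χ' := by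
  classical
  refine Finset.card_le_card fun ξ hξ => ?_
  rw [Finset.mem_filter] at hξ ⊢
  exact ⟨hξ.1, fun hc => hξ.2 (condLe_trans h hc)⟩

theorem condLe_of_condRank_le (hD : χ' ∈ D) (hv : sim a w v) (h' : χ' ∈ v)
    (h : condRank D a w χ ≤ condRank D a w χ') : condLe a w χ χ' := by
  classical
  by_contra hc
  have hle : condLe a w χ' χ := (condLe_total hv h').resolve_right hc
  refine absurd h (not_le.2 (Finset.card_lt_card ⟨fun ξ hξ => ?_, fun hsub => ?_⟩))
  · rw [Finset.mem_filter] at hξ ⊢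
    exact ⟨hξ.1, fun hξ' => hξ.2 (condLe_trans hle hξ')⟩
  · exact (Finset.mem_filter.1 (hsub (Finset.mem_filter.2 ⟨hD, hc⟩))).2 (condLe_refl hv h')

theorem condRank_le_rank (hD : χ ∈ D) (hv : sim a w v) (h : χ ∈ v) :
    condRank D a w χ ≤ rank D a v := by
  classical
  rw [condRank_congr_of_sim hv]
  exact Finset.le_sup (f := condRank D a v) (Finset.mem_filter.2 ⟨hD, h⟩)

theorem sel.rank_le (h : sel a χ w v) : rank D a v ≤ condRank D a w χ := by
  classical
  refine Finset.sup_le fun χ' hχ' => ?_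
  have hχ'v : χ' ∈ v := (Finset.mem_filter.1 hχ').2
  rw [← condRank_congr_of_sim h.sim]
  refine condRank_le_of_condLe ?_
  refine (condLe_total h.sim h.mem).elim (fun ⟨u, hu, hχu⟩ => ?_) id
  -- `v`, as a most plausible `χ`-state, is a most plausible `χ ∨ χ'`-state.
  have hv := ((sel_restrict (fun _ h => or_mem.2 (.inl h)) hu hχu).1 h).1
  refine ⟨v, fun θ hθ => hv θ ((w.mem_cbel_congr (.iff_of_forall_world fun w => ?_)
      (.iff_of_forall_world fun _ => Iff.rfl)).1 hθ), hχ'v⟩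
  rw [or_mem, or_mem, or_comm]

end World

open Classical in
/-- The conditions `χ` and `χ ∧ ¬φ` whose plausibility decides a conditional belief `Bₐ^χ φ`, for
all conditional beliefs that occur in a static formula. -/
noncomputable def conditions : Form Agent Atom Op → Finset (Form Agent Atom Op)
  | neg φ => conditions φ
  | and φ ψ => conditions φ ∪ conditions ψ
  | cbel _ χ φ => {χ, and χ (neg φ)} ∪ (conditions χ ∪ conditions φ)
  | _ => ∅

/-- The canonical model whose plausibility order is determined by the conditions in `D`. Its states
are the maximal consistent theories, coded by a type `S` in the universe of models. -/
def canonicalModel {S : Type u} (e : S ≃ World pre Red) (D : Finset (Form Agent Atom Op)) :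
    PlausModel Agent Atom where
  State := S
  sim a s t := (e s).sim a (e t)
  le a s t := (e s).rank D a ≤ (e t).rank D a
  val p := {s | atom p ∈ e s}
  sim_equiv a := (World.sim_equivalence a).comap e
  le_prewellorder a _ := isPrewellorderOn_rank (fun s => (e s).rank D a) _

theorem IsStatic.mem_truth_canonicalModel
    {act : Op → (M : PlausModel Agent Atom) → Set M.State → PlausAction Agent (Set M.State)}
    {S : Type u} (e : S ≃ World pre Red) {D : Finset (Form Agent Atom Op)}
    {φ : Form Agent Atom Op} (hφ : IsStatic φ) (hD : conditions φ ⊆ D) (s : S) :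
    s ∈ truth act φ (canonicalModel e D) ↔ φ ∈ e s := by
  classical
  induction hφ generalizing s with
  | atom p => exact Iff.rfl
  | neg φ _ ih => rw [World.neg_mem, ← ih hD]; exact Iff.rfl
  | and φ ψ _ _ ih ih' =>
    rw [conditions, Finset.union_subset_iff] at hD
    rw [World.and_mem, ← ih hD.1, ← ih' hD.2]; exact Iff.rfl
  | cbel a χ φ _ _ ih ih' =>
    simp only [conditions, Finset.union_subset_iff, Finset.insert_subset_iff,
      Finset.singleton_subset_iff] at hD
    obtain ⟨⟨hχD, hχφD⟩, hD, hD'⟩ := hD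
    constructor
    · intro h
      by_contra hc
      -- A canonical witness against the belief is a most plausible `χ`-state.
      obtain ⟨v, hv, hφv⟩ : ∃ v, World.sel a χ (e s) v ∧ φ ∉ v := by
        by_contra hno
        push Not at hno
        exact hc (World.cbel_mem_iff.2 hno)
      obtain ⟨t, rfl⟩ := e.surjective v
      refine hφv ((ih' hD' t).1 (h t ⟨⟨hv.sim, (ih hD t).2 hv.mem⟩, fun t' ht' hχ' => ?_⟩))
      exact hv.rank_le.trans (World.condRank_le_rank hχD ht' ((ih hD t').1 hχ'))
    · rintro h t ⟨⟨hst, hχt⟩, hmin⟩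
      refine (ih' hD' t).2 ?_
      by_contra hφ
      have hχt := (ih hD t).1 hχt
      have hχφ : Form.and χ (Form.neg φ) ∈ e t := World.and_mem.2 ⟨hχt, World.neg_mem.2 hφ⟩
      obtain ⟨v', hv'⟩ := World.exists_sel hst hχt
      obtain ⟨t', rfl⟩ := e.surjective v'
      -- A most plausible `χ`-state violating `φ` makes `χ ∧ ¬φ` as plausible as `χ`.
      have hrank : (e t).rank D a ≤ (e t').rank D a := hmin t' hv'.sim ((ih hD t').2 hv'.mem)
      obtain ⟨u, hu, hχφu⟩ := World.condLe_of_condRank_le hχD hst hχt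
        ((World.condRank_le_rank hχφD hst hχφ).trans (hrank.trans hv'.rank_le))
      rw [World.and_mem, World.neg_mem] at hχφu
      exact hχφu.2 (((World.sel_restrict (fun _ h => World.or_mem.2 (.inr h)) hu hχφu.1).2
        ⟨hu, hχφu.1⟩) φ h)

/-- Completeness, given soundness and the reduction to static formulas. -/
theorem derivable_of_valid
    {act : Op → (M : PlausModel Agent Atom) → Set M.State → PlausAction Agent (Set M.State)}
    {S : Type u} (e : S ≃ World pre Red)
    (hsound : ∀ φ, Derivable pre Red φ → Valid act φ) {φ : Form Agent Atom Op}
    (hred : Reducible pre Red φ) (h : Valid act φ) : Derivable pre Red φ := by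
  obtain ⟨φ', hs, hd⟩ := hred
  refine derivable_iff_forall_world.2 fun w => ?_
  obtain ⟨s, rfl⟩ := e.surjective w
  rw [(e s).iff_of_derivable hd,
    ← hs.mem_truth_canonicalModel (act := act) e (D := conditions φ') subset_rfl]
  exact (mem_truth_iff.1 (hsound _ hd _ _)).1 (h _ _)

end Form

end PlausLying

theorem mainTheorem3 (Agent Atom : Type u) :
    (∀ φ : PlausLying.PublicForm Agent Atom,
      PlausLying.PublicDerivable φ ↔ PlausLying.PublicValid φ) ∧
    (∀ φ : PlausLying.AgentForm Agent Atom,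
      PlausLying.AgentDerivable φ ↔ PlausLying.AgentValid φ) :=
  ⟨fun φ => ⟨fun h => h.valid, PlausLying.Form.derivable_of_valid (Equiv.refl _)
      (fun _ => PlausLying.PublicDerivable.valid) φ.reducible⟩,
    fun φ => ⟨fun h => h.valid, PlausLying.Form.derivable_of_valid (Equiv.refl _)
      (fun _ => PlausLying.AgentDerivable.valid) φ.reducible⟩⟩
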